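/- For a finite field $\mathbb{F}$ with $|\mathbb{F}|=2^n$ and an integer $d\ge 0$, let $G_{\mathbb F,d}=(L,R;E)$ be the bipartite graph in which $L=\mathbb{F}^2$, $R$ is the set of polynomials $S(t)=s_0+s_1t+\dots+s_dt^d$ over $\mathbb{F}$ (given by their coefficients), and $((x_1,x_2),S)\in E$ if and only if $x_2=S(x_1)$. Let $(\mathcal{X},\mathcal{Y})$ be a uniformly random edge of this graph. Alice is given the point $\mathcal{X}$, and Bob is given the polynomial $\mathcal{Y}$. They run a deterministic two-party communication protocol (a finite binary protocol tree, in which at every inner node a fixed player sends one bit that depends on that player's input). At the end each of them computes, from their own input and the transcript, a key in $\{0,1\}^n$, and these two keys are equal for every pair of inputs in $E$. Let $\mathcal{Z}$ be the key and $\mathcal{T}$ the transcript (the sequence of all bits sent) on the input pair $(\mathcal{X},\mathcal{Y})$. $H$ denotes Shannon entropy and $I(\cdot:\cdot)$ Shannon mutual information, in bits. In every such protocol where $H(\mathcal{Z})\ge n-o(n)$ and $I(\mathcal{Z}:\mathcal{T})\le o(n)$, and where $\log d\le o(n)$ (for instance $d$ is a constant, or $d=O(n)$), either there is a pair of inputs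 in $E$ on which Alice sends at least $n-o(n)$ bits, or there is a pair of inputs in $E$ on which Bob sends at least $dn-o(n)$ bits. Precisely: for all functions $\delta_H,\delta_I,\delta_d:\mathbb{N}\to\mathbb{R}$ that are $o(n)$ there is a function $g:\mathbb{N}\to\mathbb{R}$ with $g(n)=o(n)$ such that the following holds for every $n$, every $d\ge 0$ with $d\le 2^{\delta_d(n)}$, every field $\mathbb{F}$ with $|\mathbb{F}|=2^n$, and every protocol as above for $G_{\mathbb F,d}$. If $H(\mathcal{Z})\ge n-\delta_H(n)$ and $I(\mathcal{Z}:\mathcal{T})\le\delta_I(n)$, then there is $(x,y)\in E$ on which Alice sends at least $n-g(n)$ bits, or there is $(x,y)\in E$ on which Bob sends at least $dn-g(n)$ bits. -/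

import Mathlib

open Asymptotics Filter

noncomputable section

/-- Two-party deterministic communication protocol, as a finite binary tree. Alice holds an input
in `X`, Bob holds an input in `Y`. At a node `alice f P₀ P₁` Alice sends the bit `f x`, at a node
`bob g P₀ P₁` Bob sends the bit `g y`, and the players go on with `P₀` if the bit is `false` and
with `P₁` if it is `true`; so each bit depends on the sender's input and on the bits sent before.
At a leaf Alice computes her key from her input and the leaf that was reached (that is, from her
input and the transcript), and so does Bob. -/
inductive Protocol (X Y K : Type*)
  | leaf (keyA : X → K) (keyB : Y → K) : Protocol X Y K
  | alice (f : X → Bool) (P₀ P₁ : Protocol X Y K) : Protocol X Y K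
  | bob (g : Y → Bool) (P₀ P₁ : Protocol X Y K) : Protocol X Y K

namespace Protocol

variable {X Y K : Type*}

/-- The sequence of all bits sent by Alice and Bob on the inputs `x`, `y`. -/
def transcript : Protocol X Y K → X → Y → List Bool
  | leaf _ _, _, _ => []
  | alice f P₀ P₁, x, y => f x :: (bif f x then P₁.transcript x y else P₀.transcript x y)
  | bob g P₀ P₁, x, y => g y :: (bif g y then P₁.transcript x y else P₀.transcript x y)

/-- The number of bits that Alice sends on the inputs `x`, `y`. -/
def aliceBits : Protocol X Y K → X → Y → ℕ
  | leaf _ _, _, _ => 0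
  | alice f P₀ P₁, x, y => (bif f x then P₁.aliceBits x y else P₀.aliceBits x y) + 1
  | bob g P₀ P₁, x, y => bif g y then P₁.aliceBits x y else P₀.aliceBits x y

/-- The number of bits that Bob sends on the inputs `x`, `y`. -/
def bobBits : Protocol X Y K → X → Y → ℕ
  | leaf _ _, _, _ => 0
  | alice f P₀ P₁, x, y => bif f x then P₁.bobBits x y else P₀.bobBits x y
  | bob g P₀ P₁, x, y => (bif g y then P₁.bobBits x y else P₀.bobBits x y) + 1

/-- The key computed by Alice on the inputs `x`, `y`. -/
def aliceKey : Protocol X Y K → X → Y → K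
  | leaf a _, x, _ => a x
  | alice f P₀ P₁, x, y => bif f x then P₁.aliceKey x y else P₀.aliceKey x y
  | bob g P₀ P₁, x, y => bif g y then P₁.aliceKey x y else P₀.aliceKey x y

/-- The key computed by Bob on the inputs `x`, `y`. -/
def bobKey : Protocol X Y K → X → Y → K
  | leaf _ b, _, y => b y
  | alice f P₀ P₁, x, y => bif f x then P₁.bobKey x y else P₀.bobKey x y
  | bob g P₀ P₁, x, y => bif g y then P₁.bobKey x y else P₀.bobKey x y

end Protocol

/-- A point `(x₁, x₂)` of the affine plane over `F`. -/
abbrev Point (F : Type*) := F × F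

/-- A polynomial `s₀ + s₁ t + ⋯ + s_d t ^ d` of degree at most `d` over `F`, given by its
coefficients. -/
abbrev PolyCoeffs (F : Type*) (d : ℕ) := Fin (d + 1) → F

/-- The point `x` lies on the graph of the polynomial `s`. -/
def Incident {F : Type*} [Field F] {d : ℕ} (x : Point F) (s : PolyCoeffs F d) : Prop :=
  x.2 = ∑ i : Fin (d + 1), s i * x.1 ^ (i : ℕ)

/-- The edges of the bipartite incidence graph of points and polynomials. -/
abbrev IncidenceEdge (F : Type*) [Field F] (d : ℕ) :=
  {e : Point F × PolyCoeffs F d // Incident e.1 e.2}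

instance IncidenceEdge.instNonempty (F : Type*) [Field F] (d : ℕ) :
    Nonempty (IncidenceEdge F d) :=
  ⟨⟨((0, 0), fun _ => 0), by simp [Incident]⟩⟩

instance IncidenceEdge.instFintype (F : Type*) [Field F] [Fintype F] (d : ℕ) :
    Fintype (IncidenceEdge F d) :=
  Fintype.ofFinite _

/-- Shannon entropy in bits, `∑ s, P[U = s] * log₂ (1 / P[U = s])`, of the random variable
`U : Ω → S` on the finite probability space `(Ω, μ)`. -/
def shannonEntropy {Ω S : Type*} [Fintype Ω] (μ : PMF Ω) (U : Ω → S) : ℝ :=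
  open scoped Classical in
  ∑ s ∈ Finset.univ.image U, Real.negMulLog ((μ.map U s).toReal) / Real.log 2

/-- Shannon mutual information `I(U : V) = H(U) + H(V) - H(U, V)`, in bits. -/
def shannonMutualInfo {Ω S S' : Type*} [Fintype Ω] (μ : PMF Ω) (U : Ω → S) (V : Ω → S') : ℝ :=
  shannonEntropy μ U + shannonEntropy μ V - shannonEntropy μ (fun ω => (U ω, V ω))

/-- The uniform distribution on the edges of the incidence graph. -/
def uniformEdge (F : Type*) [Field F] [Fintype F] (d : ℕ) : PMF (IncidenceEdge F d) :=
  PMF.uniformOfFintype (IncidenceEdge F d)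

namespace Protocol

variable {F K : Type*} [Field F] {d : ℕ}

/-- Alice and Bob compute the same key on every pair of inputs joined by an edge. -/
def Agrees (P : Protocol (Point F) (PolyCoeffs F d) K) : Prop :=
  ∀ x y, Incident x y → P.aliceKey x y = P.bobKey x y

/-- The key as a random variable on the set of edges (Alice's and Bob's keys are equal there when
`P.Agrees` holds). -/
def keyVar (P : Protocol (Point F) (PolyCoeffs F d) K) (e : IncidenceEdge F d) : K :=
  P.aliceKey e.1.1 e.1.2

/-- The transcript as a random variable on the set of edges. -/
def transcriptVar (P : Protocol (Point F) (PolyCoeffs F d) K) (e : IncidenceEdge F d) :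
    List Bool :=
  P.transcript e.1.1 e.1.2

end Protocol

end

/-! Write q = |F|. The edges with a given key Z and transcript T lie in the rectangle A × B spanned
by their points and polynomials. Two estimates of these rectangles collide.

Upper bound (`sum_log_fiber_add_sum_log_fiberImage_le`): H(Z | T) + E log(|A||B| / #edges) ≤ log q,
a counting form of H(Z | T) + I(X : Y | Z, T) ≤ I(X : Y) = log q. Transcript rectangles are
disjoint, and either player's input determines Z given T, so refining T by Z shrinks both sides of
the rectangle.

Lower bound: if both players send few bits, at least half of the edges have |A|, |B| ≥ D
(`card_fiberImage_lt_le`). Two polynomials share at most d points, so by Cauchy–Schwarz such a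
rectangle has at most |A||B| / c edges (`mul_card_incidences_le`).

Together H(Z | T) ≤ log q - (log c) / 2 (`shannonEntropy_sub_le`). Since H(Z | T) = H(Z) - I(Z : T)
is within o(n) of n, some c = 2^o(n) gives a contradiction. -/

section Fibers

/-! ### Fibers and entropy under the uniform distribution. -/

open scoped Classical in
/-- The fiber of `U` over `s`. -/
noncomputable def fiber {Ω S : Type*} [Fintype Ω] (U : Ω → S) (s : S) : Finset Ω :=
  Finset.univ.filter fun ω => U ω = s

open scoped Classical in
/-- The image under `f` of the fiber of `U` over `s`. -/
noncomputable def fiberImage {Ω S X : Type*} [Fintype Ω] (U : Ω → S) (f : Ω → X) (s : S) : Finset X :=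
  (fiber U s).image f

variable {Ω S S' X Y K T : Type*} [Fintype Ω]

theorem mem_fiber {U : Ω → S} {s : S} {ω : Ω} : ω ∈ fiber U s ↔ U ω = s := by
  simp [fiber]

theorem mem_fiberImage {U : Ω → S} {f : Ω → X} {s : S} {x : X} :
    x ∈ fiberImage U f s ↔ ∃ ω, U ω = s ∧ f ω = x := by
  simp [fiberImage, mem_fiber]

theorem card_fiber_pos (U : Ω → S) (ω : Ω) : 0 < ((fiber U (U ω)).card : ℝ) :=
  Nat.cast_pos.2 (Finset.card_pos.2 ⟨ω, mem_fiber.2 rfl⟩)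

theorem card_fiberImage_pos (U : Ω → S) (f : Ω → X) (ω : Ω) :
    0 < ((fiberImage U f (U ω)).card : ℝ) :=
  Nat.cast_pos.2 (Finset.card_pos.2 ⟨f ω, mem_fiberImage.2 ⟨ω, rfl, rfl⟩⟩)

/-- The weights of the points in one fiber add up to `f s`; this converts sums over points into sums
over values. -/
theorem sum_div_card_fiber [DecidableEq S] (U : Ω → S) (f : S → ℝ) :
    ∑ ω, f (U ω) / ((fiber U (U ω)).card : ℝ) = ∑ s ∈ Finset.univ.image U, f s := by
  rw [← Finset.sum_fiberwise_of_maps_to (g := U) (t := Finset.univ.image U)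
    (fun ω hω => Finset.mem_image_of_mem U hω)]
  refine Finset.sum_congr rfl fun s hs => ?_
  obtain ⟨ω, -, rfl⟩ := Finset.mem_image.1 hs
  have h := card_fiber_pos U ω
  rw [Finset.sum_congr rfl (g := fun _ => f (U ω) / ((fiber U (U ω)).card : ℝ))]
  · rw [Finset.sum_const, nsmul_eq_mul]
    rw [show (Finset.univ.filter fun ω' => U ω' = U ω) = fiber U (U ω) by ext; simp [mem_fiber]]
    field_simp
  · intro ω' hω'
    rw [(Finset.mem_filter.1 hω').2]

theorem sum_card_fiber [DecidableEq S] (U : Ω → S) :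
    ∑ s ∈ Finset.univ.image U, ((fiber U s).card : ℝ) = Fintype.card Ω := by
  rw [← sum_div_card_fiber U, Finset.sum_congr rfl (g := fun _ => (1 : ℝ))]
  · simp
  · intro ω _
    exact div_self (card_fiber_pos U ω).ne'

theorem toReal_map_uniformOfFintype [Nonempty Ω] (U : Ω → S) (s : S) :
    ((PMF.uniformOfFintype Ω).map U s).toReal = ((fiber U s).card : ℝ) / Fintype.card Ω := by
  classical
  rw [PMF.map_apply, tsum_fintype, ← Finset.sum_filter]
  simp only [PMF.uniformOfFintype_apply, Finset.sum_const, nsmul_eq_mul, ENNReal.toReal_mul,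
    ENNReal.toReal_natCast, ENNReal.toReal_inv, div_eq_mul_inv]
  congr 3
  ext ω
  simp [mem_fiber, eq_comm]

theorem shannonEntropy_uniformOfFintype [Nonempty Ω] (U : Ω → S) :
    Fintype.card Ω * (shannonEntropy (PMF.uniformOfFintype Ω) U * Real.log 2) =
      ∑ ω, (Real.log (Fintype.card Ω) - Real.log (fiber U (U ω)).card) := by
  classical
  have hN : (0 : ℝ) < Fintype.card Ω := Nat.cast_pos.2 Fintype.card_pos
  have h2 : Real.log 2 ≠ 0 := (Real.log_pos one_lt_two).ne'
  have h := sum_div_card_fiber U fun s =>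
    ((fiber U s).card : ℝ) * (Real.log (Fintype.card Ω) - Real.log (fiber U s).card)
  rw [Finset.sum_congr rfl (g := fun ω =>
    Real.log (Fintype.card Ω) - Real.log (fiber U (U ω)).card) fun ω _ =>
      mul_div_cancel_left₀ _ (card_fiber_pos U ω).ne'] at h
  rw [h, shannonEntropy, Finset.sum_mul, Finset.mul_sum]
  refine Finset.sum_congr (by congr) fun s hs => ?_
  obtain ⟨ω, -, rfl⟩ := Finset.mem_image.1 hs
  have hc := card_fiber_pos U ω
  rw [toReal_map_uniformOfFintype, div_mul_cancel₀ _ h2, Real.negMulLog,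
    Real.log_div hc.ne' hN.ne']
  field_simp
  ring

/-- The entropy difference `H(V) - H(U)` under the uniform distribution. -/
theorem shannonEntropy_sub_uniformOfFintype [Nonempty Ω] (U : Ω → S) (V : Ω → S') :
    Fintype.card Ω * ((shannonEntropy (PMF.uniformOfFintype Ω) V -
      shannonEntropy (PMF.uniformOfFintype Ω) U) * Real.log 2) =
      ∑ ω, Real.log ((fiber U (U ω)).card / (fiber V (V ω)).card) := by
  rw [sub_mul, mul_sub, shannonEntropy_uniformOfFintype, shannonEntropy_uniformOfFintype,
    ← Finset.sum_sub_distrib]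
  refine Finset.sum_congr rfl fun ω _ => ?_
  rw [Real.log_div (card_fiber_pos U ω).ne' (card_fiber_pos V ω).ne']
  ring

/-! ### Entropy inequalities by counting. -/

/-- Jensen's inequality, via log u ≤ u - 1; it reduces the entropy inequalities below to counting
bounds. -/
theorem sum_log_nonpos_of_sum_le {f : Ω → ℝ} (hf : ∀ ω, 0 < f ω)
    (h : ∑ ω, f ω ≤ Fintype.card Ω) : ∑ ω, Real.log (f ω) ≤ 0 := by
  calc ∑ ω, Real.log (f ω) ≤ ∑ ω, (f ω - 1) :=
        Finset.sum_le_sum fun ω _ => Real.log_le_sub_one_of_pos (hf ω)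
    _ ≤ 0 := by
        rw [Finset.sum_sub_distrib]
        simpa using h

/-- If `z` is determined by `x` and `t`, then the images under `x` of the fibers of `(z, t)`
contained in a fiber of `t` are disjoint. -/
theorem sum_card_fiberImage_pair_le [DecidableEq K] {x : Ω → X} {z : Ω → K} {t : Ω → T}
    (hz : ∀ ω ω', x ω = x ω' → t ω = t ω' → z ω = z ω') (s : T) (J : Finset K) :
    ∑ k ∈ J, ((fiberImage (fun ω => (z ω, t ω)) x (k, s)).card : ℝ) ≤
      (fiberImage t x s).card := by
  classical
  rw [← Nat.cast_sum, ← Finset.card_biUnion]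
  · refine Nat.cast_le.2 (Finset.card_le_card fun a ha => ?_)
    obtain ⟨k, -, hk⟩ := Finset.mem_biUnion.1 ha
    obtain ⟨ω, hω, rfl⟩ := mem_fiberImage.1 hk
    exact mem_fiberImage.2 ⟨ω, congrArg Prod.snd hω, rfl⟩
  · intro k _ k' _ hne
    refine Finset.disjoint_left.2 fun a ha ha' => hne ?_
    obtain ⟨ω, hω, rfl⟩ := mem_fiberImage.1 ha
    obtain ⟨ω', hω', h⟩ := mem_fiberImage.1 ha'
    rw [Prod.mk.injEq] at hω hω'
    rw [← hω.1, ← hω'.1]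
    exact hz ω ω' h.symm (hω.2.trans hω'.2.symm)

/-- Gibbs' inequality: given `t`, the ratios of image sizes sum to at most 1 over `z` and are
compared with the conditional probabilities of `z`. So refining `t` by `z` shrinks the log-size of
the image, on average, by at least H(z | t). -/
theorem sum_log_fiberImage_pair_le {x : Ω → X} {z : Ω → K} {t : Ω → T}
    (hz : ∀ ω ω', x ω = x ω' → t ω = t ω' → z ω = z ω') :
    ∑ ω, Real.log ((fiberImage (fun ω => (z ω, t ω)) x (z ω, t ω)).card *
        (fiber t (t ω)).card / (fiberImage t x (t ω)).card /
        (fiber (fun ω => (z ω, t ω)) (z ω, t ω)).card) ≤ 0 := by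
  classical
  have hV := card_fiber_pos fun ω => (z ω, t ω)
  have hA := card_fiberImage_pos (fun ω => (z ω, t ω)) x
  refine sum_log_nonpos_of_sum_le (fun ω => ?_) ?_
  · exact div_pos (div_pos (mul_pos (hA ω) (card_fiber_pos t ω)) (card_fiberImage_pos t x ω))
      (hV ω)
  refine (sum_div_card_fiber (fun ω => (z ω, t ω)) fun v =>
    ((fiberImage (fun ω => (z ω, t ω)) x v).card * (fiber t v.2).card /
      (fiberImage t x v.2).card : ℝ)).trans_le ?_
  -- Pairs that never occur are added so that the sum over keys can be taken separately for each
  -- `s`.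
  calc _ ≤ ∑ v ∈ Finset.univ.image z ×ˢ Finset.univ.image t,
        ((fiberImage (fun ω => (z ω, t ω)) x v).card * (fiber t v.2).card /
          (fiberImage t x v.2).card : ℝ) := by
        refine Finset.sum_le_sum_of_subset_of_nonneg (fun v hv => ?_) fun _ _ _ => by positivity
        obtain ⟨ω, -, rfl⟩ := Finset.mem_image.1 hv
        simp
    _ = ∑ s ∈ Finset.univ.image t, (∑ k ∈ Finset.univ.image z,
        ((fiberImage (fun ω => (z ω, t ω)) x (k, s)).card : ℝ)) *
          ((fiber t s).card / (fiberImage t x s).card) := by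
        rw [Finset.sum_product_right]
        refine Finset.sum_congr rfl fun s _ => ?_
        rw [Finset.sum_mul]
        exact Finset.sum_congr rfl fun k _ => mul_div_assoc _ _ _
    _ ≤ ∑ s ∈ Finset.univ.image t, ((fiber t s).card : ℝ) := by
        refine Finset.sum_le_sum fun s hs => ?_
        obtain ⟨ω, -, rfl⟩ := Finset.mem_image.1 hs
        have h := card_fiberImage_pos t x ω
        calc _ ≤ ((fiberImage t x (t ω)).card : ℝ) *
              ((fiber t (t ω)).card / (fiberImage t x (t ω)).card) := by
              gcongr
              exact sum_card_fiberImage_pair_le hz _ _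
          _ = _ := by field_simp
    _ = _ := sum_card_fiber t

/-- The rectangles spanned by the fibers of a transcript function are disjoint. -/
theorem sum_card_mul_card_fiberImage_le [Fintype X] [Fintype Y] [DecidableEq T] {x : Ω → X}
    {y : Ω → Y} {t : Ω → T} {τ : X → Y → T}
    (hτ : ∀ ω ω', t ω = t ω' → τ (x ω) (y ω') = t ω) (J : Finset T) :
    ∑ s ∈ J, ((fiberImage t x s).card * (fiberImage t y s).card : ℝ) ≤
      Fintype.card X * Fintype.card Y := by
  classical
  have h : ∑ s ∈ J, (fiberImage t x s ×ˢ fiberImage t y s).card ≤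
      Fintype.card (X × Y) := by
    rw [← Finset.card_biUnion]
    · exact Finset.card_le_univ _
    · intro s _ s' _ hne
      refine Finset.disjoint_left.2 fun a ha ha' => hne ?_
      have key : ∀ r, a ∈ fiberImage t x r ×ˢ fiberImage t y r → τ a.1 a.2 = r := by
        intro r hr
        obtain ⟨h1, h2⟩ := Finset.mem_product.1 hr
        obtain ⟨ω, rfl, h3⟩ := mem_fiberImage.1 h1
        obtain ⟨ω', h4, h5⟩ := mem_fiberImage.1 h2
        rw [← h3, ← h5]
        exact hτ ω ω' h4.symm
      rw [← key s ha, ← key s' ha']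
  simp only [Finset.card_product, Fintype.card_prod] at h
  exact_mod_cast h

/-- Counting form of I(x : y | t) ≤ log q: the areas of the disjoint rectangles total at most `q`
times the number of points of `Ω`. -/
theorem sum_log_rectangle_le [Fintype X] [Fintype Y] {x : Ω → X}
    {y : Ω → Y} {t : Ω → T} {τ : X → Y → T}
    (hτ : ∀ ω ω', t ω = t ω' → τ (x ω) (y ω') = t ω) {q : ℝ} (hq : 0 < q)
    (hcard : (Fintype.card X * Fintype.card Y : ℝ) = q * Fintype.card Ω) :
    ∑ ω, Real.log ((fiberImage t x (t ω)).card * (fiberImage t y (t ω)).card / q /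
      (fiber t (t ω)).card) ≤ 0 := by
  classical
  refine sum_log_nonpos_of_sum_le (fun ω => ?_) ?_
  · exact div_pos (div_pos (mul_pos (card_fiberImage_pos t x ω) (card_fiberImage_pos t y ω)) hq)
      (card_fiber_pos t ω)
  rw [sum_div_card_fiber t fun s =>
    ((fiberImage t x s).card * (fiberImage t y s).card / q : ℝ), ← Finset.sum_div,
    div_le_iff₀ hq, mul_comm _ q, ← hcard]
  exact sum_card_mul_card_fiberImage_le hτ _

/-- The conditional entropy of `z` given `t` and the conditional mutual information of `x` and `y`
given `(z, t)` add up to at most `log q`. -/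
theorem sum_log_fiber_add_sum_log_fiberImage_le [Fintype X] [Fintype Y] {x : Ω → X}
    {y : Ω → Y} {z : Ω → K} {t : Ω → T} {τ : X → Y → T}
    (hx : ∀ ω ω', x ω = x ω' → t ω = t ω' → z ω = z ω')
    (hy : ∀ ω ω', y ω = y ω' → t ω = t ω' → z ω = z ω')
    (hτ : ∀ ω ω', t ω = t ω' → τ (x ω) (y ω') = t ω) {q : ℝ} (hq : 0 < q)
    (hcard : (Fintype.card X * Fintype.card Y : ℝ) = q * Fintype.card Ω) :
    ∑ ω, Real.log ((fiber t (t ω)).card / (fiber (fun ω => (z ω, t ω)) (z ω, t ω)).card) +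
      ∑ ω, Real.log ((fiberImage (fun ω => (z ω, t ω)) x (z ω, t ω)).card *
        (fiberImage (fun ω => (z ω, t ω)) y (z ω, t ω)).card /
          (fiber (fun ω => (z ω, t ω)) (z ω, t ω)).card) ≤
      Fintype.card Ω * Real.log q := by
  have h1 := sum_log_fiberImage_pair_le hx
  have h2 := sum_log_fiberImage_pair_le hy
  have h3 := sum_log_rectangle_le hτ hq hcard
  have h4 : (Fintype.card Ω * Real.log q : ℝ) = ∑ _ω : Ω, Real.log q := by simp
  rw [h4, ← sub_nonpos, ← Finset.sum_add_distrib, ← Finset.sum_sub_distrib]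
  -- In the product of the three arguments the image sizes for `t` alone cancel.
  refine le_trans (le_of_eq ?_) (add_nonpos (add_nonpos h1 h2) h3)
  rw [← Finset.sum_add_distrib, ← Finset.sum_add_distrib]
  refine Finset.sum_congr rfl fun ω _ => ?_
  have a1 := (card_fiber_pos t ω).ne'
  have a2 := (card_fiber_pos (fun ω => (z ω, t ω)) ω).ne'
  have a3 := (card_fiberImage_pos t x ω).ne'
  have a4 := (card_fiberImage_pos t y ω).ne'
  have a5 := (card_fiberImage_pos (fun ω => (z ω, t ω)) x ω).ne'
  have a6 := (card_fiberImage_pos (fun ω => (z ω, t ω)) y ω).ne'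
  beta_reduce at a2 a5 a6
  rw [Real.log_div a1 a2, Real.log_div (mul_ne_zero a5 a6) a2, Real.log_mul a5 a6,
    Real.log_div (div_ne_zero (mul_ne_zero a5 a1) a3) a2,
    Real.log_div (mul_ne_zero a5 a1) a3, Real.log_mul a5 a1,
    Real.log_div (div_ne_zero (mul_ne_zero a6 a1) a4) a2,
    Real.log_div (mul_ne_zero a6 a1) a4, Real.log_mul a6 a1,
    Real.log_div (div_ne_zero (mul_ne_zero a3 a4) hq.ne') a1,
    Real.log_div (mul_ne_zero a3 a4) hq.ne', Real.log_mul a3 a4]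
  ring

/-- Few points lie in fibers of `(z, t)` whose image under `x` is small, if `t` takes few values
on each fiber of `y`. -/
theorem card_fiberImage_lt_le [Fintype Y] {x : Ω → X} {y : Ω → Y} {z : Ω → K} {t : Ω → T}
    (hinj : ∀ ω ω', x ω = x ω' → y ω = y ω' → ω = ω')
    (hy : ∀ ω ω', y ω = y ω' → t ω = t ω' → z ω = z ω') {D m : ℝ} (hD : 0 ≤ D)
    (hm : ∀ b, ((fiberImage y t b).card : ℝ) ≤ m) :
    ((Finset.univ.filter fun ω =>
      ((fiberImage (fun ω => (z ω, t ω)) x (z ω, t ω)).card : ℝ) < D).card : ℝ) ≤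
      Fintype.card Y * (m * D) := by
  classical
  set Q := Finset.univ.filter fun ω =>
    ((fiberImage (fun ω => (z ω, t ω)) x (z ω, t ω)).card : ℝ) < D
  -- Fixing `y` and `t` fixes `z`, so these points lie in one fiber of `(z, t)`, and `x` is
  -- injective on them.
  have hfib : ∀ b s, ((Q.filter fun ω => y ω = b ∧ t ω = s).card : ℝ) ≤ D := by
    intro b s
    rcases (Q.filter fun ω => y ω = b ∧ t ω = s).eq_empty_or_nonempty with h | ⟨ω₀, h₀⟩
    · simpa [h] using hD
    · obtain ⟨hQ₀, rfl, rfl⟩ := Finset.mem_filter.1 h₀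
      refine le_trans (Nat.cast_le.2 ?_) (Finset.mem_filter.1 hQ₀).2.le
      refine Finset.card_le_card_of_injOn x (fun ω hω => ?_) fun ω hω ω' hω' h => ?_
      · obtain ⟨-, h1, h2⟩ := Finset.mem_filter.1 hω
        exact mem_fiberImage.2 ⟨ω, Prod.ext (hy _ _ h1 h2) h2, rfl⟩
      · exact hinj _ _ h ((Finset.mem_filter.1 hω).2.1.trans (Finset.mem_filter.1 hω').2.1.symm)
  have hrow : ∀ b, ((Q.filter fun ω => y ω = b).card : ℝ) ≤ m * D := by
    intro b
    rw [Finset.card_eq_sum_card_fiberwise (f := t) (t := fiberImage y t b), Nat.cast_sum]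
    · calc _ ≤ ∑ _s ∈ fiberImage y t b, D := by
            refine Finset.sum_le_sum fun s _ => ?_
            rw [Finset.filter_filter]
            exact hfib b s
        _ ≤ m * D := by
            rw [Finset.sum_const, nsmul_eq_mul]
            gcongr
            exact hm b
    · intro ω hω
      exact mem_fiberImage.2 ⟨ω, (Finset.mem_filter.1 hω).2, rfl⟩
  rw [Finset.card_eq_sum_card_fiberwise (f := y) (t := Finset.univ)
    fun _ _ => Finset.mem_coe.2 (Finset.mem_univ _), Nat.cast_sum]
  calc _ ≤ ∑ _b : Y, m * D := Finset.sum_le_sum fun b _ => hrow b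
    _ = _ := by simp

end Fibers

/-! ### Incidence bounds for points and polynomials. -/

section Incidences

variable {X Y : Type*}

open scoped Classical in
/-- Incidence bound for a relation in which two elements of `Y` have at most `d` common
neighbours. -/
theorem sq_card_incidences_le {r : X → Y → Prop} {d : ℝ} (A : Finset X) (B : Finset Y)
    (hd : 0 ≤ d)
    (h : ∀ y y', y ≠ y' → ((A.filter fun x => r x y ∧ r x y').card : ℝ) ≤ d) :
    (((A ×ˢ B).filter fun p => r p.1 p.2).card : ℝ) ^ 2 ≤
      A.card * (d * (B.card : ℝ) ^ 2 + ((A ×ˢ B).filter fun p => r p.1 p.2).card) := by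
  let f : X → Y → ℝ := fun x y => if r x y then 1 else 0
  have he : (((A ×ˢ B).filter fun p => r p.1 p.2).card : ℝ) = ∑ x ∈ A, ∑ y ∈ B, f x y := by
    rw [Finset.card_filter, Nat.cast_sum, Finset.sum_product]
    simp [f]
  rw [he]
  refine sq_sum_le_card_mul_sum_sq.trans ?_
  gcongr
  have hsq : ∑ x ∈ A, (∑ y ∈ B, f x y) ^ 2 = ∑ y ∈ B, ∑ y' ∈ B, ∑ x ∈ A, f x y * f x y' := by
    rw [Finset.sum_congr rfl fun x _ => by rw [sq, Finset.sum_mul_sum], Finset.sum_comm]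
    exact Finset.sum_congr rfl fun y _ => Finset.sum_comm
  -- Off the diagonal the sum counts common neighbours; on it, the neighbours of `y`, which add up
  -- to the incidence count.
  have hterm : ∀ y y', ∑ x ∈ A, f x y * f x y' ≤
      d + if y = y' then ∑ x ∈ A, f x y else 0 := by
    intro y y'
    by_cases hyy : y = y'
    · subst hyy
      rw [if_pos rfl]
      have : ∑ x ∈ A, f x y * f x y = ∑ x ∈ A, f x y :=
        Finset.sum_congr rfl fun x _ => by simp [f]
      linarith
    · rw [if_neg hyy, add_zero]
      refine le_trans (le_of_eq ?_) (h y y' hyy)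
      rw [Finset.card_filter, Nat.cast_sum]
      refine Finset.sum_congr rfl fun x _ => ?_
      by_cases h1 : r x y <;> by_cases h2 : r x y' <;> simp [f, h1, h2]
  rw [hsq]
  calc _ ≤ ∑ y ∈ B, ∑ y' ∈ B, (d + if y = y' then ∑ x ∈ A, f x y else 0) :=
        Finset.sum_le_sum fun y _ => Finset.sum_le_sum fun y' _ => hterm y y'
    _ = d * (B.card : ℝ) ^ 2 + ∑ y ∈ B, ∑ x ∈ A, f x y := by
        simp only [Finset.sum_add_distrib, Finset.sum_const, nsmul_eq_mul, Finset.sum_ite_eq]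
        rw [Finset.sum_congr rfl fun y hy => if_pos hy]
        ring
    _ = _ := by rw [Finset.sum_comm]

open scoped Classical in
/-- Large rectangles have few incidences. -/
theorem mul_card_incidences_le {r : X → Y → Prop} {d c : ℝ} (A : Finset X) (B : Finset Y)
    (hd : 0 ≤ d) (hc : 0 < c)
    (h : ∀ y y', y ≠ y' → ((A.filter fun x => r x y ∧ r x y').card : ℝ) ≤ d)
    (hA : 2 * c ^ 2 * d ≤ A.card) (hB : 2 * c ≤ B.card) :
    c * ((A ×ˢ B).filter fun p => r p.1 p.2).card ≤ A.card * B.card := by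
  have hsq := sq_card_incidences_le A B hd h
  have ha : (0 : ℝ) ≤ A.card := Nat.cast_nonneg _
  have hb : (0 : ℝ) ≤ B.card := Nat.cast_nonneg _
  have he : (0 : ℝ) ≤ ((A ×ˢ B).filter fun p => r p.1 p.2).card := Nat.cast_nonneg _
  generalize (A.card : ℝ) = a at *
  generalize (B.card : ℝ) = b at *
  generalize (((A ×ˢ B).filter fun p => r p.1 p.2).card : ℝ) = e at *
  by_contra! hlt
  -- Both terms of `hsq`, scaled by `c ^ 2`, are at most half of `(c * e) ^ 2`, the first one
  -- strictly less.
  have h1 : 2 * c ^ 2 * d * (a * b ^ 2) ≤ a * (a * b ^ 2) := by gcongr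
  have h2 : 2 * c * (a * (c * e)) ≤ b * (a * (c * e)) := by gcongr
  have h3 : a * b * (c * e) ≤ c * e * (c * e) := by gcongr
  have h4 : c ^ 2 * e ^ 2 ≤ c ^ 2 * (a * (d * b ^ 2 + e)) := by gcongr
  have h5 : (a * b) * (a * b) < (c * e) * (c * e) :=
    mul_self_lt_mul_self (by positivity) hlt
  nlinarith

/-- Two distinct polynomials of degree at most `d` have at most `d` common points. -/
theorem card_common_points_le {F : Type*} [Field F] {d : ℕ} {s s' : PolyCoeffs F d}
    (hs : s ≠ s') (A : Finset (Point F)) (hA : ∀ x ∈ A, Incident x s ∧ Incident x s') :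
    A.card ≤ d := by
  classical
  let p : Polynomial F := ∑ i : Fin (d + 1), Polynomial.monomial (i : ℕ) (s i - s' i)
  have hcoeff : ∀ i : Fin (d + 1), p.coeff i = s i - s' i := by
    intro i
    simp [p, Polynomial.coeff_monomial, Fin.val_inj]
  have hp : p ≠ 0 := by
    intro h0
    refine hs (funext fun i => sub_eq_zero.1 ?_)
    rw [← hcoeff, h0, Polynomial.coeff_zero]
  have hdeg : p.natDegree ≤ d :=
    Polynomial.natDegree_sum_le_of_forall_le _ _ fun i _ =>
      (Polynomial.natDegree_monomial_le _).trans (Nat.lt_succ_iff.1 i.2)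
  calc A.card ≤ p.roots.toFinset.card := by
        -- The abscissa determines a point of the graph and is a root of the difference.
        refine Finset.card_le_card_of_injOn Prod.fst (fun x hx => ?_) fun x hx x' hx' h => ?_
        · obtain ⟨h1, h2⟩ := hA x hx
          simp only [Incident] at h1 h2
          simp only [Finset.mem_coe, Multiset.mem_toFinset, Polynomial.mem_roots hp,
            Polynomial.IsRoot.def, p, Polynomial.eval_finsetSum, Polynomial.eval_monomial,
            sub_mul, Finset.sum_sub_distrib]
          rw [← h1, ← h2, sub_self]
        · refine Prod.ext h ?_
          rw [(hA x hx).1, (hA x' hx').1, h]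
    _ ≤ Multiset.card p.roots := Multiset.toFinset_card_le _
    _ ≤ p.natDegree := p.card_roots'
    _ ≤ d := hdeg

theorem card_incidenceEdge (F : Type*) [Field F] [Fintype F] (d : ℕ) :
    Fintype.card (IncidenceEdge F d) = Fintype.card F ^ (d + 2) := by
  let e : IncidenceEdge F d ≃ F × PolyCoeffs F d :=
    { toFun := fun p => (p.1.1.1, p.1.2)
      invFun := fun p => ⟨((p.1, ∑ i : Fin (d + 1), p.2 i * p.1 ^ (i : ℕ)), p.2), rfl⟩
      left_inv := fun p => Subtype.ext (Prod.ext (Prod.ext rfl p.2.symm) rfl)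
      right_inv := fun _ => rfl }
  rw [Fintype.card_congr e, Fintype.card_prod, Fintype.card_fun, Fintype.card_fin]
  ring

end Incidences

/-! ### Rectangles and the number of transcripts. -/

namespace Protocol

variable {X Y K : Type*}

/-- The inputs with a given transcript form a rectangle. -/
theorem transcript_eq_of_transcript_eq (P : Protocol X Y K) {x x' : X} {y y' : Y}
    (h : P.transcript x y = P.transcript x' y') : P.transcript x y' = P.transcript x y := by
  induction P with
  | leaf => rfl
  | alice f P₀ P₁ h₀ h₁ =>
    simp only [transcript, List.cons.injEq] at h ⊢
    have hfst := h.1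
    rw [← hfst] at h
    cases hf : f x <;> simp only [hf, cond_true, cond_false, true_and] at h ⊢
    · exact h₀ h
    · exact h₁ h
  | bob g P₀ P₁ h₀ h₁ =>
    simp only [transcript, List.cons.injEq] at h ⊢
    have hfst := h.1
    rw [← hfst] at h ⊢
    cases hg : g y <;> simp only [hg, cond_true, cond_false, true_and] at h ⊢
    · exact h₀ h
    · exact h₁ h

theorem aliceKey_eq_of_transcript_eq (P : Protocol X Y K) {x : X} {y y' : Y}
    (h : P.transcript x y = P.transcript x y') : P.aliceKey x y = P.aliceKey x y' := by
  induction P with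
  | leaf => rfl
  | alice f P₀ P₁ h₀ h₁ =>
    simp only [transcript, aliceKey, List.cons.injEq] at h ⊢
    cases hf : f x <;> simp only [hf, cond_true, cond_false, true_and] at h ⊢
    · exact h₀ h
    · exact h₁ h
  | bob g P₀ P₁ h₀ h₁ =>
    simp only [transcript, aliceKey, List.cons.injEq] at h ⊢
    have hfst := h.1
    rw [← hfst] at h ⊢
    cases hg : g y <;> simp only [hg, cond_true, cond_false, true_and] at h ⊢
    · exact h₀ h
    · exact h₁ h

theorem bobKey_eq_of_transcript_eq (P : Protocol X Y K) {x x' : X} {y : Y}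
    (h : P.transcript x y = P.transcript x' y) : P.bobKey x y = P.bobKey x' y := by
  induction P with
  | leaf => rfl
  | alice f P₀ P₁ h₀ h₁ =>
    simp only [transcript, bobKey, List.cons.injEq] at h ⊢
    have hfst := h.1
    rw [← hfst] at h ⊢
    cases hf : f x <;> simp only [hf, cond_true, cond_false, true_and] at h ⊢
    · exact h₀ h
    · exact h₁ h
  | bob g P₀ P₁ h₀ h₁ =>
    simp only [transcript, bobKey, List.cons.injEq] at h ⊢
    cases hg : g y <;> simp only [hg, cond_true, cond_false, true_and] at h ⊢
    · exact h₀ h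
    · exact h₁ h

theorem card_image_cons_le {S : Type*} (J : Finset S) (f : S → Bool) (u : Bool → S → List Bool)
    {m : ℝ} (hm : ∀ c, (((J.filter fun s => f s = c).image (u c)).card : ℝ) ≤ m) :
    ((J.image fun s => f s :: u (f s) s).card : ℝ) ≤ 2 * m := by
  have hsub : (J.image fun s => f s :: u (f s) s) ⊆
      ((J.filter fun s => f s = false).image (u false)).image (List.cons false) ∪
        ((J.filter fun s => f s = true).image (u true)).image (List.cons true) := by
    intro l hl
    obtain ⟨s, hs, rfl⟩ := Finset.mem_image.1 hl
    cases hf : f s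
    · exact Finset.mem_union_left _ (Finset.mem_image_of_mem _
        (Finset.mem_image_of_mem _ (Finset.mem_filter.2 ⟨hs, hf⟩)))
    · exact Finset.mem_union_right _ (Finset.mem_image_of_mem _
        (Finset.mem_image_of_mem _ (Finset.mem_filter.2 ⟨hs, hf⟩)))
  have hle := (Finset.card_le_card hsub).trans (Finset.card_union_le _ _)
  have hle' := hle.trans (add_le_add Finset.card_image_le Finset.card_image_le)
  have := hm false
  have := hm true
  have : ((J.image fun s => f s :: u (f s) s).card : ℝ) ≤
      ((J.filter fun s => f s = false).image (u false)).card +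
        ((J.filter fun s => f s = true).image (u true)).card := by exact_mod_cast hle'
  linarith

/-- The exponent may be negative when `J` is empty: this occurs once the induction has subtracted
more bits than `r` on a branch that no input takes. -/
theorem card_image_const_le {S : Type*} (J : Finset S) {r : ℝ} (hr : ∀ s ∈ J, 0 ≤ r) :
    ((J.image fun _ => ([] : List Bool)).card : ℝ) ≤ 2 ^ r := by
  rcases J.eq_empty_or_nonempty with rfl | ⟨s, hs⟩
  · simpa using Real.rpow_nonneg zero_le_two r
  · rw [Finset.image_const ⟨s, hs⟩, Finset.card_singleton, Nat.cast_one]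
    exact Real.one_le_rpow one_le_two (hr s hs)

/-- If Alice sends at most `r` bits, then for a fixed input of Bob there are at most `2 ^ r`
transcripts. -/
theorem card_image_transcript_le_of_aliceBits_le (P : Protocol X Y K) (y : Y) (J : Finset X)
    {r : ℝ} (hJ : ∀ x ∈ J, (P.aliceBits x y : ℝ) ≤ r) :
    ((J.image fun x => P.transcript x y).card : ℝ) ≤ 2 ^ r := by
  induction P generalizing J r with
  | leaf => exact card_image_const_le J fun x hx => by simpa [aliceBits] using hJ x hx
  | alice f P₀ P₁ h₀ h₁ =>
    have h2 : (2 : ℝ) ^ r = 2 * 2 ^ (r - 1) := by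
      rw [Real.rpow_sub_one two_ne_zero]; ring
    rw [h2]
    refine card_image_cons_le J f
      (fun c x => bif c then P₁.transcript x y else P₀.transcript x y) fun c => ?_
    cases c
    · refine h₀ _ fun x hx => ?_
      obtain ⟨hx, hf⟩ := Finset.mem_filter.1 hx
      have := hJ x hx
      simp only [aliceBits, hf, cond_false, Nat.cast_add, Nat.cast_one] at this
      linarith
    · refine h₁ _ fun x hx => ?_
      obtain ⟨hx, hf⟩ := Finset.mem_filter.1 hx
      have := hJ x hx
      simp only [aliceBits, hf, cond_true, Nat.cast_add, Nat.cast_one] at this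
      linarith
  | bob g P₀ P₁ h₀ h₁ =>
    simp only [transcript, aliceBits] at hJ ⊢
    -- Bob's input is fixed, hence so is his bit; prefixing it creates no new transcripts.
    cases hg : g y <;> simp only [hg, cond_true, cond_false] at hJ ⊢
    · rw [← Function.comp_def (List.cons false), ← Finset.image_image]
      exact (Nat.cast_le.2 Finset.card_image_le).trans (h₀ J hJ)
    · rw [← Function.comp_def (List.cons true), ← Finset.image_image]
      exact (Nat.cast_le.2 Finset.card_image_le).trans (h₁ J hJ)

/-- If Bob sends at most `r` bits, then for a fixed input of Alice there are at most `2 ^ r`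
transcripts. -/
theorem card_image_transcript_le_of_bobBits_le (P : Protocol X Y K) (x : X) (J : Finset Y)
    {r : ℝ} (hJ : ∀ y ∈ J, (P.bobBits x y : ℝ) ≤ r) :
    ((J.image fun y => P.transcript x y).card : ℝ) ≤ 2 ^ r := by
  induction P generalizing J r with
  | leaf => exact card_image_const_le J fun y hy => by simpa [bobBits] using hJ y hy
  | alice f P₀ P₁ h₀ h₁ =>
    simp only [transcript, bobBits] at hJ ⊢
    cases hf : f x <;> simp only [hf, cond_true, cond_false] at hJ ⊢
    · rw [← Function.comp_def (List.cons false), ← Finset.image_image]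
      exact (Nat.cast_le.2 Finset.card_image_le).trans (h₀ J hJ)
    · rw [← Function.comp_def (List.cons true), ← Finset.image_image]
      exact (Nat.cast_le.2 Finset.card_image_le).trans (h₁ J hJ)
  | bob g P₀ P₁ h₀ h₁ =>
    have h2 : (2 : ℝ) ^ r = 2 * 2 ^ (r - 1) := by
      rw [Real.rpow_sub_one two_ne_zero]; ring
    rw [h2]
    refine card_image_cons_le J g
      (fun c y => bif c then P₁.transcript x y else P₀.transcript x y) fun c => ?_
    cases c
    · refine h₀ _ fun y hy => ?_
      obtain ⟨hy, hg⟩ := Finset.mem_filter.1 hy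
      have := hJ y hy
      simp only [bobBits, hg, cond_false, Nat.cast_add, Nat.cast_one] at this
      linarith
    · refine h₁ _ fun y hy => ?_
      obtain ⟨hy, hg⟩ := Finset.mem_filter.1 hy
      have := hJ y hy
      simp only [bobBits, hg, cond_true, Nat.cast_add, Nat.cast_one] at this
      linarith

/-! ### Key agreement on the incidence graph. -/

variable {F : Type*} [Field F] {d : ℕ}

theorem keyVar_eq_of_fst_eq (P : Protocol (Point F) (PolyCoeffs F d) K)
    (e e' : IncidenceEdge F d) (h : e.1.1 = e'.1.1) (ht : P.transcriptVar e = P.transcriptVar e') :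
    P.keyVar e = P.keyVar e' := by
  simp only [keyVar, transcriptVar] at ht ⊢
  rw [h] at ht ⊢
  exact P.aliceKey_eq_of_transcript_eq ht

theorem keyVar_eq_of_snd_eq (P : Protocol (Point F) (PolyCoeffs F d) K) (hP : P.Agrees)
    (e e' : IncidenceEdge F d) (h : e.1.2 = e'.1.2) (ht : P.transcriptVar e = P.transcriptVar e') :
    P.keyVar e = P.keyVar e' := by
  simp only [keyVar, transcriptVar] at ht ⊢
  rw [hP _ _ e.2, hP _ _ e'.2]
  rw [h] at ht ⊢
  exact P.bobKey_eq_of_transcript_eq ht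

variable [Fintype F]

theorem card_fiberImage_transcriptVar_le_alice (P : Protocol (Point F) (PolyCoeffs F d) K) {r : ℝ}
    (hr : ∀ x y, Incident x y → (P.aliceBits x y : ℝ) ≤ r) (y : PolyCoeffs F d) :
    ((fiberImage (fun e : IncidenceEdge F d => e.1.2) P.transcriptVar y).card : ℝ) ≤ 2 ^ r := by
  classical
  refine le_trans (Nat.cast_le.2 (Finset.card_le_card fun l hl => ?_))
    (P.card_image_transcript_le_of_aliceBits_le y (Finset.univ.filter fun x => Incident x y)
      fun x hx => hr x y (Finset.mem_filter.1 hx).2)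
  obtain ⟨e, rfl, rfl⟩ := mem_fiberImage.1 hl
  exact Finset.mem_image.2 ⟨e.1.1, by simpa using e.2, rfl⟩

theorem card_fiberImage_transcriptVar_le_bob (P : Protocol (Point F) (PolyCoeffs F d) K) {r : ℝ}
    (hr : ∀ x y, Incident x y → (P.bobBits x y : ℝ) ≤ r) (x : Point F) :
    ((fiberImage (fun e : IncidenceEdge F d => e.1.1) P.transcriptVar x).card : ℝ) ≤ 2 ^ r := by
  classical
  refine le_trans (Nat.cast_le.2 (Finset.card_le_card fun l hl => ?_))
    (P.card_image_transcript_le_of_bobBits_le x (Finset.univ.filter fun y => Incident x y)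
      fun y hy => hr x y (Finset.mem_filter.1 hy).2)
  obtain ⟨e, rfl, rfl⟩ := mem_fiberImage.1 hl
  exact Finset.mem_image.2 ⟨e.1.2, by simpa using e.2, rfl⟩

/-- If all edges of a fiber span a rectangle with large sides, the fiber fills a small part of the
rectangle. -/
theorem mul_card_fiber_le {S : Type*} (V : IncidenceEdge F d → S) (s : S) {c : ℝ} (hc : 0 < c)
    (hA : 2 * c ^ 2 * d ≤ (fiberImage V (fun e => e.1.1) s).card)
    (hB : 2 * c ≤ (fiberImage V (fun e => e.1.2) s).card) :
    c * (fiber V s).card ≤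
      (fiberImage V (fun e => e.1.1) s).card * (fiberImage V (fun e => e.1.2) s).card := by
  classical
  refine le_trans ?_ (mul_card_incidences_le (r := Incident) _ _ (Nat.cast_nonneg d) hc
    (fun y y' hy => Nat.cast_le.2 (card_common_points_le hy _ fun x hx =>
      (Finset.mem_filter.1 hx).2)) hA hB)
  gcongr
  refine Finset.card_le_card_of_injOn Subtype.val (fun e he => ?_)
    Subtype.val_injective.injOn
  have he := mem_fiber.1 he
  exact Finset.mem_filter.2 ⟨Finset.mem_product.2
    ⟨mem_fiberImage.2 ⟨e, he, rfl⟩, mem_fiberImage.2 ⟨e, he, rfl⟩⟩, e.2⟩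

/-- The trivial density bound, used for the exceptional edges, where only nonnegativity of the
logarithm is needed. -/
theorem card_fiber_le {S : Type*} (V : IncidenceEdge F d → S) (s : S) :
    ((fiber V s).card : ℝ) ≤
      (fiberImage V (fun e => e.1.1) s).card * (fiberImage V (fun e => e.1.2) s).card := by
  classical
  rw [← Nat.cast_mul, ← Finset.card_product]
  refine Nat.cast_le.2 (Finset.card_le_card_of_injOn Subtype.val (fun e he => ?_)
    Subtype.val_injective.injOn)
  have he := mem_fiber.1 he
  exact Finset.mem_product.2 ⟨mem_fiberImage.2 ⟨e, he, rfl⟩, mem_fiberImage.2 ⟨e, he, rfl⟩⟩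

/-- Short messages leave at most `log₂ |F| - log₂ c / 2` bits of entropy in the key, given the
transcript. -/
theorem shannonEntropy_sub_le (P : Protocol (Point F) (PolyCoeffs F d) K) (hP : P.Agrees)
    {D c rA rB : ℝ} (hD : 0 ≤ D) (hc : 1 ≤ c) (hDA : 2 * c ^ 2 * d ≤ D) (hDB : 2 * c ≤ D)
    (hA : ∀ x y, Incident x y → (P.aliceBits x y : ℝ) ≤ rA)
    (hB : ∀ x y, Incident x y → (P.bobBits x y : ℝ) ≤ rB)
    (hrA : 4 * (2 ^ rA * D) ≤ Fintype.card F) (hrB : 4 * (2 ^ rB * D) ≤ Fintype.card F ^ d) :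
    (shannonEntropy (uniformEdge F d) (fun e => (P.keyVar e, P.transcriptVar e)) -
      shannonEntropy (uniformEdge F d) P.transcriptVar) * Real.log 2 ≤
      Real.log (Fintype.card F) - Real.log c / 2 := by
  classical
  have hq : (0 : ℝ) < Fintype.card F := Nat.cast_pos.2 Fintype.card_pos
  set N : ℝ := (Fintype.card (IncidenceEdge F d) : ℝ) with hNdef
  have hN : N = (Fintype.card F : ℝ) ^ (d + 2) := by
    rw [hNdef, card_incidenceEdge, Nat.cast_pow]
  have hNpos : 0 < N := hN ▸ pow_pos hq _
  have hX : (Fintype.card (Point F) : ℝ) = (Fintype.card F : ℝ) ^ 2 := by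
    rw [Fintype.card_prod, Nat.cast_mul, sq]
  have hY : (Fintype.card (PolyCoeffs F d) : ℝ) = (Fintype.card F : ℝ) ^ (d + 1) := by
    rw [Fintype.card_fun, Fintype.card_fin, Nat.cast_pow]
  set V : IncidenceEdge F d → K × List Bool := fun e => (P.keyVar e, P.transcriptVar e)
  have hsum := sum_log_fiber_add_sum_log_fiberImage_le (x := fun e : IncidenceEdge F d => e.1.1)
    (y := fun e => e.1.2) (τ := P.transcript) P.keyVar_eq_of_fst_eq (P.keyVar_eq_of_snd_eq hP)
    (fun e e' h => P.transcript_eq_of_transcript_eq h) hq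
    (by rw [hX, hY, ← hNdef, hN]; ring)
  have hbadA := card_fiberImage_lt_le (x := fun e : IncidenceEdge F d => e.1.1)
    (y := fun e => e.1.2) (fun e e' h h' => Subtype.ext (Prod.ext h h'))
    (P.keyVar_eq_of_snd_eq hP) hD (P.card_fiberImage_transcriptVar_le_alice hA)
  have hbadB := card_fiberImage_lt_le (x := fun e : IncidenceEdge F d => e.1.2)
    (y := fun e => e.1.1) (fun e e' h h' => Subtype.ext (Prod.ext h' h))
    P.keyVar_eq_of_fst_eq hD (P.card_fiberImage_transcriptVar_le_bob hB)
  rw [hY] at hbadA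
  rw [hX] at hbadB
  set QA := Finset.univ.filter fun e : IncidenceEdge F d =>
    ((fiberImage V (fun e => e.1.1) (V e)).card : ℝ) < D
  set QB := Finset.univ.filter fun e : IncidenceEdge F d =>
    ((fiberImage V (fun e => e.1.2) (V e)).card : ℝ) < D
  -- Each exceptional set has at most a quarter of the edges, which leaves half of them for the
  -- incidence bound.
  have hQA : 4 * (QA.card : ℝ) ≤ N := by
    have := mul_le_mul_of_nonneg_left hrA (pow_pos hq (d + 1)).le
    rw [hN, pow_succ _ (d + 1)]
    linarith
  have hQB : 4 * (QB.card : ℝ) ≤ N := by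
    have := mul_le_mul_of_nonneg_left hrB (pow_pos hq 2).le
    rw [hN, pow_add, mul_comm (_ ^ d)]
    linarith
  -- The indicators make the coefficient of `Real.log c` nonpositive on exceptional edges; an edge
  -- in both sets is subtracted twice, which is harmless.
  have hlogc : 0 ≤ Real.log c := Real.log_nonneg hc
  have hterm : ∀ e : IncidenceEdge F d, (1 - (if e ∈ QA then 1 else 0) -
      (if e ∈ QB then 1 else 0)) * Real.log c ≤
      Real.log ((fiberImage V (fun e => e.1.1) (V e)).card *
        (fiberImage V (fun e => e.1.2) (V e)).card / (fiber V (V e)).card) := by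
    intro e
    have hpos := card_fiber_pos V e
    by_cases hgood : e ∉ QA ∧ e ∉ QB
    · rw [if_neg hgood.1, if_neg hgood.2, sub_zero, sub_zero, one_mul]
      have h1 : D ≤ (fiberImage V (fun e => e.1.1) (V e)).card := by
        simpa [QA] using hgood.1
      have h2 : D ≤ (fiberImage V (fun e => e.1.2) (V e)).card := by
        simpa [QB] using hgood.2
      refine Real.log_le_log (by linarith) ((le_div_iff₀ hpos).2 ?_)
      exact mul_card_fiber_le V (V e) (by linarith) (hDA.trans h1) (hDB.trans h2)
    · refine le_trans (mul_nonpos_of_nonpos_of_nonneg ?_ hlogc)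
        (Real.log_nonneg ((one_le_div hpos).2 (card_fiber_le V (V e))))
      by_cases h1 : e ∈ QA
      · rw [if_pos h1]; split_ifs <;> norm_num
      · rw [if_pos (by tauto : e ∈ QB), if_neg h1]; norm_num
  have hsum2 := Finset.sum_le_sum fun e (_ : e ∈ Finset.univ) => hterm e
  rw [← Finset.sum_mul, Finset.sum_sub_distrib, Finset.sum_sub_distrib, Finset.sum_const,
    Finset.sum_boole, Finset.sum_boole, Finset.filter_univ_mem, Finset.filter_univ_mem,
    nsmul_eq_mul, mul_one, Finset.card_univ, ← hNdef] at hsum2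
  have hhalf : N / 2 * Real.log c ≤ (N - QA.card - QB.card) * Real.log c := by
    gcongr
    linarith
  have hent := shannonEntropy_sub_uniformOfFintype P.transcriptVar V
  refine le_of_mul_le_mul_left ?_ hNpos
  change N * ((shannonEntropy (PMF.uniformOfFintype _) V -
    shannonEntropy (PMF.uniformOfFintype _) P.transcriptVar) * Real.log 2) ≤ _
  rw [hent]
  linarith

end Protocol

/-! ### Choice of the error term. -/

theorem claim6 (δH δI δd : ℕ → ℝ)
    (hδH : δH =o[atTop] (fun n : ℕ => (n : ℝ)))
    (hδI : δI =o[atTop] (fun n : ℕ => (n : ℝ)))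
    (hδd : δd =o[atTop] (fun n : ℕ => (n : ℝ))) :
    ∃ g : ℕ → ℝ, g =o[atTop] (fun n : ℕ => (n : ℝ)) ∧
      ∀ (n d : ℕ) (F : Type*) [Field F] [Fintype F],
        Fintype.card F = 2 ^ n →
        (d : ℝ) ≤ (2 : ℝ) ^ (δd n) →
        ∀ P : Protocol (Point F) (PolyCoeffs F d) (Fin n → Bool),
          P.Agrees →
          (n : ℝ) - δH n ≤ shannonEntropy (uniformEdge F d) P.keyVar →
          shannonMutualInfo (uniformEdge F d) P.keyVar P.transcriptVar ≤ δI n →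
          (∃ (x : Point F) (y : PolyCoeffs F d), Incident x y ∧
              (n : ℝ) - g n ≤ P.aliceBits x y) ∨
          (∃ (x : Point F) (y : PolyCoeffs F d), Incident x y ∧
              (d : ℝ) * n - g n ≤ P.bobBits x y) := by
  -- With c = 2^k and D = 2^(g - 2), the final 2 in the exponent absorbs the factor 4 of the quarter
  -- bounds, and D = 2c² · 2^|δd|. The absolute value keeps D ≥ 2c when δd is negative, in which
  -- case d = 0.
  refine ⟨fun n => 4 * (|δH n| + |δI n|) + |δd n| + 5, ?_, ?_⟩
  · refine IsLittleO.add (IsLittleO.add (IsLittleO.const_mul_left (hδH.abs_left.add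
      hδI.abs_left) 4) hδd.abs_left) ?_
    exact (isLittleO_const_id_atTop (5 : ℝ)).comp_tendsto tendsto_natCast_atTop_atTop
  intro n d F _ _ hF hd P hP hH hI
  by_contra! hcon
  obtain ⟨hA, hB⟩ := hcon
  set k : ℝ := 2 * (|δH n| + |δI n|) + 1 with hk
  set g : ℝ := 4 * (|δH n| + |δI n|) + |δd n| + 5 with hg
  have hk0 : 0 ≤ k := by positivity
  have hgk : g - 2 = 1 + 2 * k + |δd n| := by rw [hg, hk]; ring
  have h2 : (0 : ℝ) < 2 := two_pos
  have hd' : (d : ℝ) ≤ 2 ^ |δd n| :=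
    hd.trans (Real.rpow_le_rpow_of_exponent_le one_le_two (le_abs_self _))
  have hD : (2 : ℝ) ^ (g - 2) = 2 * (2 ^ k) ^ 2 * 2 ^ |δd n| := by
    rw [hgk, Real.rpow_add h2, Real.rpow_add h2, Real.rpow_one, mul_comm 2 k, Real.rpow_mul h2.le,
      Real.rpow_two]
  have hc : (1 : ℝ) ≤ 2 ^ k := Real.one_le_rpow one_le_two hk0
  have hone : (1 : ℝ) ≤ 2 ^ |δd n| := Real.one_le_rpow one_le_two (abs_nonneg _)
  have hfour : (4 : ℝ) = 2 ^ (2 : ℝ) := by norm_num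
  have hcomb : ∀ a : ℝ, 4 * ((2 : ℝ) ^ (a - g) * 2 ^ (g - 2)) = 2 ^ a := by
    intro a
    rw [hfour, ← Real.rpow_add h2, ← Real.rpow_add h2]
    congr 1
    ring
  have hmain := P.shannonEntropy_sub_le hP (D := 2 ^ (g - 2)) (c := 2 ^ k) (rA := n - g)
    (rB := d * n - g) (by positivity) hc ?_ ?_ (fun x y h => (hA x y h).le)
    (fun x y h => (hB x y h).le) ?_ ?_
  · have hlog := Real.log_pos one_lt_two
    rw [hF, Nat.cast_pow, Nat.cast_ofNat, Real.log_pow, Real.log_rpow h2,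
      show (n * Real.log 2 - k * Real.log 2 / 2 : ℝ) = (n - k / 2) * Real.log 2 by ring] at hmain
    have hle := le_of_mul_le_mul_right hmain hlog
    -- The entropy difference is H(Z) - I(Z : T) ≥ n - δH - δI, while k / 2 exceeds |δH| + |δI| by
    -- 1/2.
    rw [shannonMutualInfo] at hI
    have := le_abs_self (δH n)
    have := le_abs_self (δI n)
    linarith
  · rw [hD]
    gcongr
  · rw [hD]
    nlinarith [mul_le_mul hc hone zero_le_one (by positivity)]
  · rw [hcomb, hF, Nat.cast_pow, Nat.cast_ofNat, Real.rpow_natCast]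
  · rw [hcomb, hF, Nat.cast_pow, Nat.cast_ofNat, ← pow_mul, mul_comm n d, ← Nat.cast_mul,
      Real.rpow_natCast]
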